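/- Let $n,m,r,k\ge 0$ be integers with $k<n$, and let $\Sigma$ be the bilinear control system $$\dot x(t)=Ax(t)+\sum_{i=1}^m N_i x(t)w_i(t)+Bu(t),\qquad y(t)=Cx(t),$$ with $A,N_1,\dots,N_m\in\mathbb R^{n\times n}$, $B\in\mathbb R^{n\times r}$, $C\in\mathbb R^{r\times n}$. Assume that $A=A^T$ is negative definite, $N_i=N_i^T$ for all $i$, and $B=C^T$. Let $\mathcal L(X)=AX+XA^T$ and $\Pi(X)=\sum_{i=1}^m N_iXN_i^T$ on $\mathbb R^{n\times n}$, and assume that the spectral radius satisfies $\rho(\mathcal L^{-1}\Pi)<1$. Let $V\in\mathbb R^{n\times k}$ satisfy $V^TV=I_k$, and let $\widehat\Sigma$ be the reduced bilinear system with coefficients $\hat A=V^TAV$, $\hat N_i=V^TN_iV$, $\hat B=V^TB$, $\hat C=\hat B^T$. For a bilinear system $\Sigma$ with coefficients $A,N_i,B=[b_1,\dots,b_r],C$, put $$\|\Sigma\|_{\mathcal H_2}^2=\operatorname{trace}\Big(\sum_{j=1}^\infty\int_{[0,\infty)^j}\ \sum_{\ell_1,\dots,\ell_{j-1}=1}^m\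 \sum_{a=1}^r g\,g^T\,ds_1\cdots ds_j\Big)\in[0,\infty],$$ $$g=Ce^{As_j}N_{\ell_1}e^{As_{j-1}}N_{\ell_2}\cdots N_{\ell_{j-1}}e^{As_1}b_a\in\mathbb R^r .$$ The error system $\Sigma-\widehat\Sigma$ has the coefficients $$\begin{bmatrix}A&0\\0&\hat A\end{bmatrix},\quad \begin{bmatrix}N_i&0\\0&\hat N_i\end{bmatrix},\quad \begin{bmatrix}B\\ \hat B\end{bmatrix},\quad \begin{bmatrix}C&-\hat C\end{bmatrix}.$$ Call $\widehat\Sigma$ locally $\mathcal H_2$-optimal if, among all stable bilinear systems $\widetilde\Sigma$ of dimension $k$ (all eigenvalues of $\tilde A$ in the open left half-plane, and otherwise arbitrary coefficients $\tilde A,\tilde N_i,\tilde B,\tilde C$), it is a local minimizer of $\|\Sigma-\widetilde\Sigma\|_{\mathcal H_2}$ with respect to the coefficients. Then $\|\Sigma\|_{\mathcal H_2}$, $\|\widehat\Sigma\|_{\mathcal H_2}$ and $\|\Sigma-\widehat\Sigma\|_{\mathcal H_2}$ are finite and $$\|\Sigma-\widehat\Sigma\|_{\mathcal H_2}^2\le\|\Sigma\|_{\mathcal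 H_2}^2-\|\widehat\Sigma\|_{\mathcal H_2}^2,$$ with equality if $\widehat\Sigma$ is locally $\mathcal H_2$-optimal. -/

import Mathlib

open scoped Matrix TensorProduct ENNReal

noncomputable section

/-- The Lyapunov operator `X ↦ A X + X Aᵀ` on real square matrices. -/
def lyapunovOp {n : ℕ} (A : Matrix (Fin n) (Fin n) ℝ) :
    Module.End ℝ (Matrix (Fin n) (Fin n) ℝ) :=
  LinearMap.mulLeft ℝ A + LinearMap.mulRight ℝ Aᵀ

/-- The correction `X ↦ ∑ i, Nᵢ X Nᵢᵀ` on real square matrices. -/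
def correctionOp {n m : ℕ} (N : Fin m → Matrix (Fin n) (Fin n) ℝ) :
    Module.End ℝ (Matrix (Fin n) (Fin n) ℝ) :=
  ∑ i, LinearMap.mulLeft ℝ (N i) * LinearMap.mulRight ℝ (N i)ᵀ

theorem lyapunovOp_apply {n : ℕ} (A X : Matrix (Fin n) (Fin n) ℝ) :
    lyapunovOp A X = A * X + X * Aᵀ := rfl

theorem correctionOp_apply {n m : ℕ} (N : Fin m → Matrix (Fin n) (Fin n) ℝ)
    (X : Matrix (Fin n) (Fin n) ℝ) :
    correctionOp N X = ∑ i, N i * X * (N i)ᵀ := by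
  simp [correctionOp, mul_assoc]

/-- The spectral radius of a linear operator on a real vector space: the supremum of the moduli of
all its complex spectral values, that is, the spectral radius of its complexification. -/
def realSpectralRadius {E : Type*} [AddCommGroup E] [Module ℝ E] (T : Module.End ℝ E) : ℝ≥0∞ :=
  spectralRadius ℂ (LinearMap.baseChange ℂ T : Module.End ℂ (ℂ ⊗[ℝ] E))

/-- The bilinear control system
`x' = A x + ∑ i, wᵢ Nᵢ x + B u`, `y = C x`, with state coordinates indexed by `ι`, bilinear inputs
`w ∈ ℝᵐ`, linear inputs `u ∈ ℝʳ` and outputs `y ∈ ℝʳ`. -/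
@[ext]
structure BilinearSystem (ι : Type*) (m r : ℕ) where
  A : Matrix ι ι ℝ
  N : Fin m → Matrix ι ι ℝ
  B : Matrix ι (Fin r) ℝ
  C : Matrix (Fin r) ι ℝ

namespace BilinearSystem

/-- Systems carry the topology of their coefficients. -/
instance {ι : Type*} {m r : ℕ} : TopologicalSpace (BilinearSystem ι m r) :=
  TopologicalSpace.induced (fun S => (S.A, S.N, S.B, S.C)) inferInstance

/-- All (complex) eigenvalues of `A` lie in the open left half-plane. -/
def IsStable {ι : Type*} [Fintype ι] [DecidableEq ι] {m r : ℕ} (S : BilinearSystem ι m r) : Prop :=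
  ∀ z ∈ spectrum ℂ (S.A.map (algebraMap ℝ ℂ)), z.re < 0

/-- The input-to-state kernel with `j + 1` time arguments `s 0, …, s j`,
`e^{s_j A} N_{ℓ 0} e^{s_{j-1} A} N_{ℓ 1} ⋯ N_{ℓ (j-1)} e^{s_0 A} B`. -/
def stateKernel {ι : Type*} [Fintype ι] [DecidableEq ι] {m r : ℕ} (S : BilinearSystem ι m r) :
    (j : ℕ) → (Fin j → Fin m) → (Fin (j + 1) → ℝ) → Matrix ι (Fin r) ℝ
  | 0, _, s => NormedSpace.exp (s 0 • S.A) * S.B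
  | j + 1, ℓ, s =>
      NormedSpace.exp (s (Fin.last (j + 1)) • S.A) * S.N (ℓ 0) *
        S.stateKernel j (Fin.tail ℓ) (Fin.init s)

/-- The Volterra kernel
`g = C e^{s_j A} N_{ℓ 0} e^{s_{j-1} A} ⋯ N_{ℓ (j-1)} e^{s_0 A} b_a ∈ ℝʳ`,
where `b_a` is the `a`-th column of `B`. -/
def volterraKernel {ι : Type*} [Fintype ι] [DecidableEq ι] {m r : ℕ} (S : BilinearSystem ι m r)
    (j : ℕ) (ℓ : Fin j → Fin m) (a : Fin r) (s : Fin (j + 1) → ℝ) : Fin r → ℝ :=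
  (S.C * S.stateKernel j ℓ s).col a

/-- The squared `H₂`-norm, i.e. the trace of
`∑ j, ∫_{[0,∞)^{j+1}} ∑_{ℓ, a} g gᵀ ds` with `g` the Volterra kernels.
The diagonal entries of `g gᵀ` are nonnegative, so each diagonal entry of this matrix is a
well-defined element of `[0, ∞]`; the norm is infinite exactly when the series diverges. -/
def h2NormSq {ι : Type*} [Fintype ι] [DecidableEq ι] {m r : ℕ} (S : BilinearSystem ι m r) :
    ℝ≥0∞ :=
  ∑ p : Fin r, ∑' j : ℕ, ∫⁻ s in Set.Ici (0 : Fin (j + 1) → ℝ),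
    ENNReal.ofReal ((∑ ℓ : Fin j → Fin m, ∑ a : Fin r,
      Matrix.vecMulVec (S.volterraKernel j ℓ a s) (S.volterraKernel j ℓ a s)) p p)

/-- The error system `S - T`: both systems are driven by the same inputs and the outputs are
subtracted. -/
def errorSystem {ι κ : Type*} {m r : ℕ} (S : BilinearSystem ι m r) (T : BilinearSystem κ m r) :
    BilinearSystem (ι ⊕ κ) m r where
  A := Matrix.fromBlocks S.A 0 0 T.A
  N := fun i => Matrix.fromBlocks (S.N i) 0 0 (T.N i)
  B := Matrix.fromRows S.B T.B
  C := Matrix.fromCols S.C (-T.C)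

/-- The reduced system `Â = Vᵀ A V`, `N̂ᵢ = Vᵀ Nᵢ V`, `B̂ = Vᵀ B = Ĉᵀ`. -/
def symmReduction {n k m r : ℕ} (S : BilinearSystem (Fin n) m r) (V : Matrix (Fin n) (Fin k) ℝ) :
    BilinearSystem (Fin k) m r where
  A := Vᵀ * S.A * V
  N := fun i => Vᵀ * S.N i * V
  B := Vᵀ * S.B
  C := (Vᵀ * S.B)ᵀ

/-- `T` is locally `H₂`-optimal for `S`: among the stable systems with the state dimension of `T`
(and arbitrary coefficients near those of `T`), `T` minimizes the `H₂`-norm of the error. -/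
def IsLocallyH2Optimal {ι κ : Type*} [Fintype ι] [DecidableEq ι] [Fintype κ] [DecidableEq κ]
    {m r : ℕ} (S : BilinearSystem ι m r) (T : BilinearSystem κ m r) : Prop :=
  T.IsStable ∧
    IsLocalMinOn (fun T' : BilinearSystem κ m r => (S.errorSystem T').h2NormSq)
      {T' | T'.IsStable} T

end BilinearSystem

end

/-! Equip matrices with the Frobenius inner product and write `R` for the reduced system. The
Gramians `P`, `Y`, `Z` of the pairs (`S`,`S`), (`S`,`R`), (`R`,`R`) are series of iterated integrals
of kernel products. Each solves its generalized Lyapunov equation, e.g. `negLyapunov S R Y = S.B *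
R.Bᵀ`, and the block form of the error system gives error² = tr(C P Cᵀ) - 2 tr(C Y Ĉᵀ) + tr(Ĉ Z Ĉᵀ).
The inequality therefore amounts to tr(Ĉ Z Ĉᵀ) ≤ tr(C Y Ĉᵀ).

By symmetry of the coefficients, H = `negLyapunov S R` is self-adjoint, and it is nonnegative
because it is a compression of the coercive operator `negLyapunov S S`. Since VᵀV = 1, compressing H
once more gives the reduced operator, so VZ is the Galerkin approximation of Y. Expanding 0 ≤ ⟨Y -
VZ, H(Y - VZ)⟩ and using B = Cᵀ gives the trace inequality (`trace_reduced_le_trace_mixed`).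

Coercivity comes from the spectral radius: a maximizer of the Rayleigh quotient of Π against -L is
an eigenvector of L⁻¹Π (`isCoercive_of_realSpectralRadius_lt_one`). Coercivity also bounds the
partial sums of the Gramian series, hence finiteness.

For equality, varying only the scale t of the output matrix Ĉ is enough: error² is then a quadratic
in t, and a critical point at t = 1 says tr(C Y Ĉᵀ) = tr(Ĉ Z Ĉᵀ) (`trace_eq_of_isLocallyH2Optimal`).
-/

open MeasureTheory Filter Topology

/-! ### Matrix exponentials of negative definite matrices and the Lyapunov integral. -/

section ExponentialDecay

variable {ι κ : Type*} [Fintype ι] [DecidableEq ι] [Fintype κ] [DecidableEq κ]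

theorem exists_exp_smul_apply_eq_sum {A : Matrix ι ι ℝ} (hA : (-A).PosDef) :
    ∃ (U : Matrix ι ι ℝ) (μ : ι → ℝ), (∀ i, 0 < μ i) ∧ ∀ (t : ℝ) (i j : ι),
      NormedSpace.exp (t • A) i j = ∑ l, U i l * U j l * Real.exp (-μ l * t) := by
  set U : Matrix ι ι ℝ := (hA.1.eigenvectorUnitary).1 with hU
  have hmul : U * star U = 1 := Unitary.coe_mul_star_self hA.1.eigenvectorUnitary
  have hinv : U⁻¹ = star U := Matrix.inv_eq_right_inv hmul
  have hunit : IsUnit U := (Matrix.isUnit_iff_isUnit_det U).2 (Matrix.isUnit_det_of_right_inverse hmul)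
  refine ⟨U, hA.1.eigenvalues, hA.eigenvalues_pos, fun t i j => ?_⟩
  have hdiag : t • A = U * Matrix.diagonal (fun l => -hA.1.eigenvalues l * t) * U⁻¹ := by
    have h := hA.1.spectral_theorem
    rw [Unitary.conjStarAlgAut_apply] at h
    have h2 : t • A = -(t • (-A)) := by simp
    rw [h2, hinv]
    conv_lhs => rw [h]
    rw [← Matrix.smul_mul, ← Matrix.mul_smul, ← Matrix.neg_mul, ← Matrix.mul_neg,
      ← Matrix.diagonal_smul]
    congr 2
    ext l l'
    by_cases hl : l = l'
    · subst hl
      simp [mul_comm]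
    · simp [hl]
  rw [hdiag, Matrix.exp_conj _ _ hunit, Matrix.exp_diagonal, hinv, Matrix.mul_apply]
  refine Finset.sum_congr rfl fun l _ => ?_
  rw [Matrix.mul_diagonal, Matrix.star_apply]
  simp only [Pi.coe_exp, ← Real.exp_eq_exp_ℝ, star_trivial]
  ring

/-- Finite sums of decaying exponentials make both integrability on the half-line and the limit at
infinity immediate. -/
theorem exists_exp_mul_exp_eq_sum {A : Matrix ι ι ℝ} {B : Matrix κ κ ℝ} (hA : (-A).PosDef)
    (hB : (-B).PosDef) (a c : ι) (b d : κ) :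
    ∃ (u : ι × κ → ℝ) (μ : ι × κ → ℝ), (∀ q, 0 < μ q) ∧ ∀ t : ℝ,
      NormedSpace.exp (t • A) a c * NormedSpace.exp (t • B) b d
        = ∑ q, u q * Real.exp (-μ q * t) := by
  obtain ⟨U, μ, hμ, hU⟩ := exists_exp_smul_apply_eq_sum hA
  obtain ⟨W, ν, hν, hW⟩ := exists_exp_smul_apply_eq_sum hB
  refine ⟨fun q => U a q.1 * U c q.1 * (W b q.2 * W d q.2), fun q => μ q.1 + ν q.2,
    fun q => add_pos (hμ _) (hν _), fun t => ?_⟩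
  rw [hU, hW, Finset.sum_mul_sum, Fintype.sum_prod_type]
  refine Finset.sum_congr rfl fun i _ => Finset.sum_congr rfl fun j _ => ?_
  rw [show -(μ i + ν j) * t = -μ i * t + -ν j * t by ring, Real.exp_add]
  ring

theorem integrableOn_exp_mul_exp {A : Matrix ι ι ℝ} {B : Matrix κ κ ℝ} (hA : (-A).PosDef)
    (hB : (-B).PosDef) (a c : ι) (b d : κ) :
    IntegrableOn (fun t : ℝ => NormedSpace.exp (t • A) a c * NormedSpace.exp (t • B) b d)
      (Set.Ioi 0) := by
  obtain ⟨u, μ, hμ, h⟩ := exists_exp_mul_exp_eq_sum hA hB a c b d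
  simp only [h]
  exact integrable_finsetSum _ fun q _ => (exp_neg_integrableOn_Ioi 0 (hμ q)).const_mul (u q)

theorem tendsto_exp_mul_exp {A : Matrix ι ι ℝ} {B : Matrix κ κ ℝ} (hA : (-A).PosDef)
    (hB : (-B).PosDef) (a c : ι) (b d : κ) :
    Tendsto (fun t : ℝ => NormedSpace.exp (t • A) a c * NormedSpace.exp (t • B) b d)
      atTop (𝓝 0) := by
  obtain ⟨u, μ, hμ, h⟩ := exists_exp_mul_exp_eq_sum hA hB a c b d
  simp only [h]
  rw [show (0 : ℝ) = ∑ q, u q * 0 by simp]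
  refine tendsto_finsetSum _ fun q _ => Tendsto.const_mul _ ?_
  refine Real.tendsto_exp_atBot.comp ?_
  exact tendsto_id.const_mul_atTop_of_neg (neg_lt_zero.2 (hμ q))

theorem hasDerivAt_exp_smul_apply (A : Matrix ι ι ℝ) (t : ℝ) (a c : ι) :
    HasDerivAt (fun t : ℝ => NormedSpace.exp (t • A) a c)
      (∑ e, A a e * NormedSpace.exp (t • A) e c) t := by
  let : NormedRing (Matrix ι ι ℝ) := Matrix.linftyOpNormedRing
  let : NormedAlgebra ℝ (Matrix ι ι ℝ) := Matrix.linftyOpNormedAlgebra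
  have h := hasDerivAt_exp_smul_const' (𝕂 := ℝ) A t
  let φ : Matrix ι ι ℝ →L[ℝ] ℝ := LinearMap.toContinuousLinearMap (Matrix.entryLinearMap ℝ ℝ a c)
  have h2 := φ.hasFDerivAt.comp_hasDerivAt t h
  exact h2

/-- The integral `∫₀^∞ e^{tA} X e^{tBᵀ} dt`, computed entrywise. -/
noncomputable def lyapunovIntegral (A : Matrix ι ι ℝ) (B : Matrix κ κ ℝ) (X : Matrix ι κ ℝ) : Matrix ι κ ℝ :=
  Matrix.of fun a b => ∑ c, ∑ d,
    (∫ t in Set.Ioi (0 : ℝ), NormedSpace.exp (t • A) a c * NormedSpace.exp (t • B) b d) * X c d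

/-- The left side is the integral of the derivative of the product of the two exponential entries;
the boundary term vanishes at infinity and is a product of identity entries at 0. -/
theorem sum_integral_exp_mul_exp {A : Matrix ι ι ℝ} {B : Matrix κ κ ℝ} (hA : (-A).PosDef)
    (hB : (-B).PosDef) (a c : ι) (b d : κ) :
    (∑ e, A a e * ∫ t in Set.Ioi (0 : ℝ),
        NormedSpace.exp (t • A) e c * NormedSpace.exp (t • B) b d)
      + (∑ e, B b e * ∫ t in Set.Ioi (0 : ℝ),
        NormedSpace.exp (t • A) a c * NormedSpace.exp (t • B) e d)
      = -((1 : Matrix ι ι ℝ) a c * (1 : Matrix κ κ ℝ) b d) := by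
  have hd : ∀ t : ℝ, HasDerivAt
      (fun t : ℝ => NormedSpace.exp (t • A) a c * NormedSpace.exp (t • B) b d)
      ((∑ e, A a e * (NormedSpace.exp (t • A) e c * NormedSpace.exp (t • B) b d))
        + ∑ e, B b e * (NormedSpace.exp (t • A) a c * NormedSpace.exp (t • B) e d)) t := by
    intro t
    refine ((hasDerivAt_exp_smul_apply A t a c).mul
      (hasDerivAt_exp_smul_apply B t b d)).congr_deriv ?_
    rw [Finset.sum_mul, Finset.mul_sum]
    congr 1 <;> exact Finset.sum_congr rfl fun e _ => by ring
  have hi1 : IntegrableOn (fun t : ℝ => ∑ e, A a e *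
      (NormedSpace.exp (t • A) e c * NormedSpace.exp (t • B) b d)) (Set.Ioi 0) :=
    integrable_finsetSum _ fun e _ => (integrableOn_exp_mul_exp hA hB e c b d).const_mul _
  have hi2 : IntegrableOn (fun t : ℝ => ∑ e, B b e *
      (NormedSpace.exp (t • A) a c * NormedSpace.exp (t • B) e d)) (Set.Ioi 0) :=
    integrable_finsetSum _ fun e _ => (integrableOn_exp_mul_exp hA hB a c e d).const_mul _
  have h := integral_Ioi_of_hasDerivAt_of_tendsto (a := 0) (hd 0).continuousAt.continuousWithinAt
    (fun t _ => hd t) (hi1.add hi2) (tendsto_exp_mul_exp hA hB a c b d)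
  rw [integral_add hi1 hi2,
    integral_finsetSum _ fun e _ => (integrableOn_exp_mul_exp hA hB e c b d).const_mul _,
    integral_finsetSum _ fun e _ => (integrableOn_exp_mul_exp hA hB a c e d).const_mul _] at h
  simp only [integral_const_mul] at h
  rw [h]
  simp

theorem lyapunovIntegral_equation {A : Matrix ι ι ℝ} {B : Matrix κ κ ℝ} (hA : (-A).PosDef)
    (hB : (-B).PosDef) (X : Matrix ι κ ℝ) :
    A * lyapunovIntegral A B X + lyapunovIntegral A B X * Bᵀ = -X := by
  ext a b
  simp only [Matrix.add_apply, Matrix.mul_apply, lyapunovIntegral, Matrix.of_apply,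
    Matrix.transpose_apply, Matrix.neg_apply]
  have h1 : ∀ F : ι → ι → κ → ℝ, ∑ e, A a e * ∑ c, ∑ d, F e c d * X c d
      = ∑ c, ∑ d, (∑ e, A a e * F e c d) * X c d := by
    intro F
    simp only [Finset.mul_sum, Finset.sum_mul]
    rw [Finset.sum_comm]
    refine Finset.sum_congr rfl fun c _ => ?_
    rw [Finset.sum_comm]
    exact Finset.sum_congr rfl fun d _ => Finset.sum_congr rfl fun e _ => by ring
  have h2 : ∀ F : κ → ι → κ → ℝ, ∑ e, (∑ c, ∑ d, F e c d * X c d) * B b e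
      = ∑ c, ∑ d, (∑ e, B b e * F e c d) * X c d := by
    intro F
    simp only [Finset.sum_mul]
    rw [Finset.sum_comm]
    refine Finset.sum_congr rfl fun c _ => ?_
    rw [Finset.sum_comm]
    exact Finset.sum_congr rfl fun d _ => Finset.sum_congr rfl fun e _ => by ring
  rw [h1, h2]
  simp only [← Finset.sum_add_distrib, ← add_mul, sum_integral_exp_mul_exp hA hB]
  simp [Matrix.one_apply]

end ExponentialDecay

/-! ### Integration over the orthant, one time variable at a time. -/

section Orthant

theorem volume_restrict_Ici_zero (j : ℕ) :
    (volume : Measure (Fin j → ℝ)).restrict (Set.Ici 0)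
      = Measure.pi fun _ => (volume : Measure ℝ).restrict (Set.Ioi 0) := by
  rw [← Set.pi_univ_Ici, volume_pi, Measure.restrict_pi_pi]
  congr 1
  funext i
  exact (Measure.restrict_congr_set Ioi_ae_eq_Ici).symm

/-- The last time variable belongs to the outermost exponential of the kernel; splitting it off
makes the iterated integrals factor. -/
theorem measurePreserving_last_init (j : ℕ) :
    MeasurePreserving (MeasurableEquiv.piFinSuccAbove (fun _ : Fin (j + 1) => ℝ) (Fin.last j))
      (volume.restrict (Set.Ici 0))
      ((volume.restrict (Set.Ioi 0)).prod (volume.restrict (Set.Ici 0))) := by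
  rw [volume_restrict_Ici_zero, volume_restrict_Ici_zero]
  exact measurePreserving_piFinSuccAbove
    (fun _ : Fin (j + 1) => (volume : Measure ℝ).restrict (Set.Ioi 0)) (Fin.last j)

theorem integrableOn_last_mul_init {j : ℕ} {g : ℝ → ℝ} {F : (Fin j → ℝ) → ℝ}
    (hg : IntegrableOn g (Set.Ioi 0)) (hF : IntegrableOn F (Set.Ici 0)) :
    IntegrableOn (fun s : Fin (j + 1) → ℝ => g (s (Fin.last j)) * F (Fin.init s)) (Set.Ici 0) := by
  have h := ((measurePreserving_last_init j).integrable_comp_emb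
    (MeasurableEquiv.measurableEmbedding _)).2 (hg.mul_prod hF)
  refine h.congr (Eventually.of_forall fun s => ?_)
  simp [MeasurableEquiv.piFinSuccAbove_apply]

theorem integral_last_mul_init {j : ℕ} (g : ℝ → ℝ) (F : (Fin j → ℝ) → ℝ) :
    ∫ s in Set.Ici (0 : Fin (j + 1) → ℝ), g (s (Fin.last j)) * F (Fin.init s)
      = (∫ t in Set.Ioi (0 : ℝ), g t) * ∫ s in Set.Ici (0 : Fin j → ℝ), F s := by
  rw [← integral_prod_mul, ← (measurePreserving_last_init j).integral_comp']
  refine integral_congr_ae (Eventually.of_forall fun s => ?_)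
  simp [MeasurableEquiv.piFinSuccAbove_apply]

theorem measurePreserving_funUnique_Ici :
    MeasurePreserving (MeasurableEquiv.funUnique (Fin 1) ℝ)
      (volume.restrict (Set.Ici 0)) (volume.restrict (Set.Ioi 0)) := by
  rw [volume_restrict_Ici_zero]
  convert measurePreserving_funUnique ((volume : Measure ℝ).restrict (Set.Ioi 0)) (Fin 1)
  all_goals rfl

theorem integrableOn_fin_one {g : ℝ → ℝ} (hg : IntegrableOn g (Set.Ioi 0)) :
    IntegrableOn (fun s : Fin 1 → ℝ => g (s 0)) (Set.Ici 0) := by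
  have h := measurePreserving_funUnique_Ici
  exact (h.integrable_comp_emb (MeasurableEquiv.measurableEmbedding _)).2 hg

theorem integral_fin_one (g : ℝ → ℝ) :
    ∫ s in Set.Ici (0 : Fin 1 → ℝ), g (s 0) = ∫ t in Set.Ioi (0 : ℝ), g t := by
  have h := measurePreserving_funUnique_Ici
  exact h.integral_comp' g

end Orthant

/-! ### Mixed Gramians and their recursion. -/

namespace BilinearSystem

variable {ι κ : Type*} [Fintype ι] [DecidableEq ι] [Fintype κ] [DecidableEq κ] {m r : ℕ}

/-- The integrand `∑ ℓ, x_ℓ(s) y_ℓ(s)ᵀ` of the mixed Gramian of two systems, where `x_ℓ` and `y_ℓ`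
are their input-to-state kernels. -/
noncomputable def gramKernel (S : BilinearSystem ι m r) (T : BilinearSystem κ m r) (j : ℕ)
    (s : Fin (j + 1) → ℝ) : Matrix ι κ ℝ :=
  ∑ ℓ : Fin j → Fin m, S.stateKernel j ℓ s * (T.stateKernel j ℓ s)ᵀ

/-- The mixed correction `X ↦ ∑ i, Nᵢ X Mᵢᵀ`. -/
noncomputable def mixedCorrection (S : BilinearSystem ι m r) (T : BilinearSystem κ m r) (X : Matrix ι κ ℝ) :
    Matrix ι κ ℝ :=
  ∑ i, S.N i * X * (T.N i)ᵀ

/-- The contribution of the kernels with `j + 1` time arguments to the mixed Gramian. -/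
noncomputable def gram (S : BilinearSystem ι m r) (T : BilinearSystem κ m r) (j : ℕ) : Matrix ι κ ℝ :=
  Matrix.of fun a b => ∫ s in Set.Ici (0 : Fin (j + 1) → ℝ), gramKernel S T j s a b

theorem gramKernel_zero (S : BilinearSystem ι m r) (T : BilinearSystem κ m r) (s : Fin 1 → ℝ) :
    gramKernel S T 0 s
      = NormedSpace.exp (s 0 • S.A) * (S.B * T.Bᵀ) * (NormedSpace.exp (s 0 • T.A))ᵀ := by
  simp [gramKernel, stateKernel, Matrix.transpose_mul, Matrix.mul_assoc]

/-- The sum over multi-indices is split at its first index, which labels the outermost `N`; that sum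
becomes `mixedCorrection`. -/
theorem gramKernel_succ (S : BilinearSystem ι m r) (T : BilinearSystem κ m r) (j : ℕ)
    (s : Fin (j + 2) → ℝ) :
    gramKernel S T (j + 1) s
      = NormedSpace.exp (s (Fin.last (j + 1)) • S.A)
        * mixedCorrection S T (gramKernel S T j (Fin.init s))
        * (NormedSpace.exp (s (Fin.last (j + 1)) • T.A))ᵀ := by
  unfold gramKernel mixedCorrection
  rw [← (Fin.consEquiv fun _ : Fin (j + 1) => Fin m).sum_comp, Fintype.sum_prod_type,
    Matrix.mul_sum, Matrix.sum_mul]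
  refine Finset.sum_congr rfl fun i _ => ?_
  rw [Matrix.mul_sum, Matrix.sum_mul, Matrix.mul_sum, Matrix.sum_mul]
  refine Finset.sum_congr rfl fun ℓ _ => ?_
  simp [stateKernel, Fin.consEquiv, Matrix.transpose_mul, Matrix.mul_assoc]

theorem mul_mul_transpose_apply {ι κ : Type*} [Fintype ι] [Fintype κ] (P : Matrix ι ι ℝ) (X : Matrix ι κ ℝ) (Q : Matrix κ κ ℝ)
    (a : ι) (b : κ) : (P * X * Qᵀ) a b = ∑ c, ∑ d, P a c * Q b d * X c d := by
  simp only [Matrix.mul_apply, Matrix.transpose_apply, Finset.sum_mul]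
  rw [Finset.sum_comm]
  exact Finset.sum_congr rfl fun c _ => Finset.sum_congr rfl fun d _ => by ring

theorem mixedCorrection_apply {ι κ : Type*} [Fintype ι] [Fintype κ] (S : BilinearSystem ι m r) (T : BilinearSystem κ m r)
    (X : Matrix ι κ ℝ) (a : ι) (b : κ) :
    mixedCorrection S T X a b = ∑ i, ∑ c, ∑ d, S.N i a c * T.N i b d * X c d := by
  simp only [mixedCorrection, Matrix.sum_apply, mul_mul_transpose_apply]

theorem integrableOn_gramKernel {S : BilinearSystem ι m r} {T : BilinearSystem κ m r}
    (hS : (-S.A).PosDef) (hT : (-T.A).PosDef) (j : ℕ) (a : ι) (b : κ) :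
    IntegrableOn (fun s => gramKernel S T j s a b) (Set.Ici 0) := by
  induction j generalizing a b with
  | zero =>
    simp only [gramKernel_zero, mul_mul_transpose_apply]
    exact integrable_finsetSum _ fun c _ => integrable_finsetSum _ fun d _ =>
      (integrableOn_fin_one (integrableOn_exp_mul_exp hS hT a c b d)).mul_const _
  | succ j ih =>
    simp only [gramKernel_succ, mul_mul_transpose_apply]
    refine integrable_finsetSum _ fun c _ => integrable_finsetSum _ fun d _ =>
      integrableOn_last_mul_init (integrableOn_exp_mul_exp hS hT a c b d)
        (F := fun s => mixedCorrection S T (gramKernel S T j s) c d) ?_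
    simp only [mixedCorrection_apply]
    exact integrable_finsetSum _ fun i _ => integrable_finsetSum _ fun e _ =>
      integrable_finsetSum _ fun f _ => (ih e f).const_mul _

theorem gram_zero {S : BilinearSystem ι m r} {T : BilinearSystem κ m r}
    (hS : (-S.A).PosDef) (hT : (-T.A).PosDef) :
    gram S T 0 = lyapunovIntegral S.A T.A (S.B * T.Bᵀ) := by
  ext a b
  simp only [gram, lyapunovIntegral, Matrix.of_apply, gramKernel_zero, mul_mul_transpose_apply]
  have hi : ∀ c d, IntegrableOn (fun s : Fin 1 → ℝ => NormedSpace.exp (s 0 • S.A) a c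
      * NormedSpace.exp (s 0 • T.A) b d * (S.B * T.Bᵀ) c d) (Set.Ici 0) := fun c d =>
    (integrableOn_fin_one (integrableOn_exp_mul_exp hS hT a c b d)).mul_const _
  rw [integral_finsetSum _ fun c _ => integrable_finsetSum _ fun d _ => hi c d]
  refine Finset.sum_congr rfl fun c _ => ?_
  rw [integral_finsetSum _ fun d _ => hi c d]
  refine Finset.sum_congr rfl fun d _ => ?_
  rw [integral_mul_const, integral_fin_one (fun t => NormedSpace.exp (t • S.A) a c
      * NormedSpace.exp (t • T.A) b d)]

theorem integral_mixedCorrection_gramKernel {S : BilinearSystem ι m r} {T : BilinearSystem κ m r}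
    (hS : (-S.A).PosDef) (hT : (-T.A).PosDef) (j : ℕ) (a : ι) (b : κ) :
    ∫ s in Set.Ici (0 : Fin (j + 1) → ℝ), mixedCorrection S T (gramKernel S T j s) a b
      = mixedCorrection S T (gram S T j) a b := by
  simp only [mixedCorrection_apply]
  have hi : ∀ i e f, IntegrableOn (fun s => S.N i a e * T.N i b f * gramKernel S T j s e f)
      (Set.Ici 0) := fun i e f => (integrableOn_gramKernel hS hT j e f).const_mul _
  rw [integral_finsetSum _ fun i _ => integrable_finsetSum _ fun e _ =>
    integrable_finsetSum _ fun f _ => hi i e f]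
  refine Finset.sum_congr rfl fun i _ => ?_
  rw [integral_finsetSum _ fun e _ => integrable_finsetSum _ fun f _ => hi i e f]
  refine Finset.sum_congr rfl fun e _ => ?_
  rw [integral_finsetSum _ fun f _ => hi i e f]
  refine Finset.sum_congr rfl fun f _ => ?_
  rw [integral_const_mul]
  rfl

theorem integrableOn_mixedCorrection_gramKernel {S : BilinearSystem ι m r}
    {T : BilinearSystem κ m r} (hS : (-S.A).PosDef) (hT : (-T.A).PosDef) (j : ℕ) (a : ι) (b : κ) :
    IntegrableOn (fun s => mixedCorrection S T (gramKernel S T j s) a b) (Set.Ici 0) := by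
  simp only [mixedCorrection_apply]
  exact integrable_finsetSum _ fun i _ => integrable_finsetSum _ fun e _ =>
    integrable_finsetSum _ fun f _ => (integrableOn_gramKernel hS hT j e f).const_mul _

theorem gram_succ {S : BilinearSystem ι m r} {T : BilinearSystem κ m r}
    (hS : (-S.A).PosDef) (hT : (-T.A).PosDef) (j : ℕ) :
    gram S T (j + 1) = lyapunovIntegral S.A T.A (mixedCorrection S T (gram S T j)) := by
  ext a b
  have hi : ∀ c d, IntegrableOn (fun s : Fin (j + 2) → ℝ =>
      NormedSpace.exp (s (Fin.last (j + 1)) • S.A) a c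
      * NormedSpace.exp (s (Fin.last (j + 1)) • T.A) b d
      * mixedCorrection S T (gramKernel S T j (Fin.init s)) c d) (Set.Ici 0) := fun c d =>
    integrableOn_last_mul_init (integrableOn_exp_mul_exp hS hT a c b d)
      (integrableOn_mixedCorrection_gramKernel hS hT j c d)
  rw [gram, lyapunovIntegral]
  simp only [Matrix.of_apply, gramKernel_succ, mul_mul_transpose_apply]
  rw [integral_finsetSum _ fun c _ => integrable_finsetSum _ fun d _ => hi c d]
  refine Finset.sum_congr rfl fun c _ => ?_
  rw [integral_finsetSum _ fun d _ => hi c d]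
  refine Finset.sum_congr rfl fun d _ => ?_
  rw [integral_last_mul_init (fun t => NormedSpace.exp (t • S.A) a c
      * NormedSpace.exp (t • T.A) b d) fun s => mixedCorrection S T (gramKernel S T j s) c d,
    integral_mixedCorrection_gramKernel hS hT]

/-- Pointwise 2|xy| ≤ x² + y². It reduces convergence of mixed Gramians to diagonal entries of the
Gramians of each system. -/
theorem abs_gram_apply_le {S : BilinearSystem ι m r} {T : BilinearSystem κ m r}
    (hS : (-S.A).PosDef) (hT : (-T.A).PosDef) (j : ℕ) (a : ι) (b : κ) :
    |gram S T j a b| ≤ gram S S j a a + gram T T j b b := by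
  have h : ∀ s, |gramKernel S T j s a b| ≤ gramKernel S S j s a a + gramKernel T T j s b b := by
    intro s
    simp only [gramKernel, Matrix.sum_apply, Matrix.mul_apply, Matrix.transpose_apply,
      ← Finset.sum_add_distrib]
    refine (Finset.abs_sum_le_sum_abs _ _).trans (Finset.sum_le_sum fun ℓ _ =>
      (Finset.abs_sum_le_sum_abs _ _).trans (Finset.sum_le_sum fun p _ => ?_))
    rw [abs_le]
    constructor <;> nlinarith [sq_nonneg (S.stateKernel j ℓ s a p + T.stateKernel j ℓ s b p),
      sq_nonneg (S.stateKernel j ℓ s a p - T.stateKernel j ℓ s b p),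
      sq_nonneg (S.stateKernel j ℓ s a p), sq_nonneg (T.stateKernel j ℓ s b p)]
  simp only [gram, Matrix.of_apply]
  rw [← integral_add (integrableOn_gramKernel hS hS j a a) (integrableOn_gramKernel hT hT j b b)]
  refine abs_integral_le_integral_abs.trans (integral_mono (integrableOn_gramKernel hS hT j a b).abs
    ((integrableOn_gramKernel hS hS j a a).add (integrableOn_gramKernel hT hT j b b)) h)

theorem gram_zero_equation {S : BilinearSystem ι m r} {T : BilinearSystem κ m r}
    (hS : (-S.A).PosDef) (hT : (-T.A).PosDef) :
    S.A * gram S T 0 + gram S T 0 * T.Aᵀ = -(S.B * T.Bᵀ) := by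
  rw [gram_zero hS hT, lyapunovIntegral_equation hS hT]

theorem gram_succ_equation {S : BilinearSystem ι m r} {T : BilinearSystem κ m r}
    (hS : (-S.A).PosDef) (hT : (-T.A).PosDef) (j : ℕ) :
    S.A * gram S T (j + 1) + gram S T (j + 1) * T.Aᵀ = -mixedCorrection S T (gram S T j) := by
  rw [gram_succ hS hT, lyapunovIntegral_equation hS hT]

end BilinearSystem

/-! ### Trace inequalities for the Frobenius inner product. -/

section

open scoped MatrixOrder Matrix.Norms.L2Operator

theorem Matrix.PosSemidef.exists_eq_conjTranspose_mul_self {ι : Type*} [Fintype ι] [DecidableEq ι]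
    {X : Matrix ι ι ℝ} (hX : X.PosSemidef) : ∃ M : Matrix ι ι ℝ, X = Mᴴ * M :=
  CStarAlgebra.nonneg_iff_eq_star_mul_self.1 hX.nonneg

end

theorem Matrix.PosSemidef.trace_mul_nonneg {ι : Type*} [Fintype ι]
    {X Y : Matrix ι ι ℝ} (hX : X.PosSemidef) (hY : Y.PosSemidef) : 0 ≤ (X * Y).trace := by
  classical
  obtain ⟨M, rfl⟩ := hX.exists_eq_conjTranspose_mul_self
  rw [Matrix.mul_assoc, Matrix.trace_mul_comm]
  exact (hY.mul_mul_conjTranspose_same M).trace_nonneg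

theorem Matrix.trace_transpose_mul_eq_sum {ι κ : Type*} [Fintype ι] [Fintype κ]
    (X Y : Matrix ι κ ℝ) : (Xᵀ * Y).trace = ∑ a, ∑ b, X a b * Y a b := by
  simp only [Matrix.trace, Matrix.diag, Matrix.mul_apply, Matrix.transpose_apply]
  exact Finset.sum_comm

theorem Matrix.trace_transpose_mul_comm {ι κ : Type*} [Fintype ι] [Fintype κ]
    (X Y : Matrix ι κ ℝ) : (Xᵀ * Y).trace = (Yᵀ * X).trace := by
  simp only [Matrix.trace_transpose_mul_eq_sum, mul_comm]

theorem Matrix.sq_apply_le_trace {ι κ : Type*} [Fintype ι] [Fintype κ]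
    (X : Matrix ι κ ℝ) (a : ι) (b : κ) : X a b ^ 2 ≤ (Xᵀ * X).trace := by
  rw [Matrix.trace_transpose_mul_eq_sum]
  calc X a b ^ 2 ≤ ∑ b, X a b * X a b := by
        rw [sq]
        exact Finset.single_le_sum (f := fun b => X a b * X a b)
          (fun b _ => mul_self_nonneg _) (Finset.mem_univ b)
    _ ≤ ∑ a, ∑ b, X a b * X a b :=
        Finset.single_le_sum (f := fun a => ∑ b, X a b * X a b)
          (fun a _ => Finset.sum_nonneg fun b _ => mul_self_nonneg _) (Finset.mem_univ a)

/-! ### Convergence of the Gramian series under coercivity. -/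

namespace BilinearSystem

variable {ι κ : Type*} [Fintype ι] [Fintype κ] {m r : ℕ}

/-- The negative generalized Lyapunov operator `X ↦ -(A X + X A'ᵀ + ∑ i, Nᵢ X Nᵢ'ᵀ)` of two
systems. -/
noncomputable def negLyapunov (S : BilinearSystem ι m r) (T : BilinearSystem κ m r) (X : Matrix ι κ ℝ) :
    Matrix ι κ ℝ :=
  -(S.A * X + X * T.Aᵀ + mixedCorrection S T X)

/-- Coercivity of the negative generalized Lyapunov operator with respect to the Frobenius inner
product. -/
def IsCoercive (S : BilinearSystem ι m r) : Prop :=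
  ∃ δ > 0, ∀ X : Matrix ι ι ℝ, δ * (Xᵀ * X).trace ≤ (Xᵀ * negLyapunov S S X).trace

theorem mixedCorrection_add (S : BilinearSystem ι m r) (T : BilinearSystem κ m r)
    (X Y : Matrix ι κ ℝ) :
    mixedCorrection S T (X + Y) = mixedCorrection S T X + mixedCorrection S T Y := by
  simp only [mixedCorrection, Matrix.mul_add, Matrix.add_mul, Finset.sum_add_distrib]

theorem mixedCorrection_zero (S : BilinearSystem ι m r) (T : BilinearSystem κ m r) :
    mixedCorrection S T 0 = 0 := by
  simp [mixedCorrection]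

theorem negLyapunov_add (S : BilinearSystem ι m r) (T : BilinearSystem κ m r)
    (X Y : Matrix ι κ ℝ) :
    negLyapunov S T (X + Y) = negLyapunov S T X + negLyapunov S T Y := by
  simp only [negLyapunov, mixedCorrection_add, Matrix.mul_add, Matrix.add_mul]
  abel

theorem continuous_mixedCorrection (S : BilinearSystem ι m r) (T : BilinearSystem κ m r) :
    Continuous (mixedCorrection S T) := by
  unfold mixedCorrection
  fun_prop

variable [DecidableEq ι] [DecidableEq κ]

theorem posSemidef_gramKernel (S : BilinearSystem ι m r) (j : ℕ) (s : Fin (j + 1) → ℝ) :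
    (gramKernel S S j s).PosSemidef := by
  refine Matrix.posSemidef_sum _ fun ℓ _ => ?_
  have h := Matrix.posSemidef_self_mul_conjTranspose (S.stateKernel j ℓ s)
  rwa [Matrix.conjTranspose_eq_transpose_of_trivial] at h

theorem posSemidef_gram {S : BilinearSystem ι m r} (hS : (-S.A).PosDef) (j : ℕ) :
    (gram S S j).PosSemidef := by
  refine Matrix.PosSemidef.of_dotProduct_mulVec_nonneg ?_ fun x => ?_
  · ext a b
    simp only [gram, Matrix.conjTranspose_apply, Matrix.of_apply, star_trivial]
    congr 1
    funext s
    have h := congrFun (congrFun (posSemidef_gramKernel S j s).1 a) b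
    simpa using h
  · have h : star x ⬝ᵥ gram S S j *ᵥ x = ∫ s in Set.Ici (0 : Fin (j + 1) → ℝ),
        star x ⬝ᵥ gramKernel S S j s *ᵥ x := by
      simp only [dotProduct, Matrix.mulVec, gram, Matrix.of_apply, Finset.mul_sum]
      have hi : ∀ a b, IntegrableOn (fun s => star x a * (gramKernel S S j s a b * x b))
          (Set.Ici 0) := fun a b =>
        ((integrableOn_gramKernel hS hS j a b).mul_const _).const_mul _
      rw [integral_finsetSum _ fun a _ => integrable_finsetSum _ fun b _ => hi a b]
      refine Finset.sum_congr rfl fun a _ => ?_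
      rw [integral_finsetSum _ fun b _ => hi a b]
      refine Finset.sum_congr rfl fun b _ => ?_
      rw [integral_const_mul, integral_mul_const]
    rw [h]
    exact integral_nonneg fun s => (posSemidef_gramKernel S j s).dotProduct_mulVec_nonneg x

theorem posSemidef_mixedCorrection {ι : Type*} [Fintype ι] (S : BilinearSystem ι m r)
    {X : Matrix ι ι ℝ} (hX : X.PosSemidef) : (mixedCorrection S S X).PosSemidef := by
  refine Matrix.posSemidef_sum _ fun i _ => ?_
  have h := hX.mul_mul_conjTranspose_same (S.N i)
  rwa [Matrix.conjTranspose_eq_transpose_of_trivial] at h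

/-- The sum telescopes: the Lyapunov part of each term cancels the correction of its predecessor. -/
theorem negLyapunov_sum_gram {S : BilinearSystem ι m r} {T : BilinearSystem κ m r}
    (hS : (-S.A).PosDef) (hT : (-T.A).PosDef) (J : ℕ) :
    negLyapunov S T (∑ j ∈ Finset.range (J + 1), gram S T j)
      = S.B * T.Bᵀ - mixedCorrection S T (gram S T J) := by
  induction J with
  | zero =>
    rw [zero_add, Finset.sum_range_one, negLyapunov, gram_zero_equation hS hT]
    abel
  | succ J ih =>
    rw [Finset.sum_range_succ, negLyapunov_add, ih, negLyapunov, gram_succ_equation hS hT]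
    abel

/-- With Q the partial sum and b = BBᵀ, the telescoped remainder pairs nonnegatively with Q, so
δ‖Q‖² ≤ ⟨Q, b⟩ and hence ‖Q‖ ≤ ‖b‖/δ, uniformly in `J`. -/
theorem trace_sum_gram_le {S : BilinearSystem ι m r} (hS : (-S.A).PosDef) {δ : ℝ} (hδ : 0 < δ)
    (h : ∀ X : Matrix ι ι ℝ, δ * (Xᵀ * X).trace ≤ (Xᵀ * negLyapunov S S X).trace) (J : ℕ) :
    ((∑ j ∈ Finset.range (J + 1), gram S S j)ᵀ * ∑ j ∈ Finset.range (J + 1), gram S S j).trace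
      ≤ ((S.B * S.Bᵀ)ᵀ * (S.B * S.Bᵀ)).trace / δ ^ 2 := by
  set Q := ∑ j ∈ Finset.range (J + 1), gram S S j with hQ
  have hQpos : Q.PosSemidef := Matrix.posSemidef_sum _ fun j _ => posSemidef_gram hS j
  have h1 := h Q
  rw [negLyapunov_sum_gram hS hS, Matrix.mul_sub, Matrix.trace_sub] at h1
  have h2 : 0 ≤ (Qᵀ * mixedCorrection S S (gram S S J)).trace :=
    hQpos.transpose.trace_mul_nonneg (posSemidef_mixedCorrection S (posSemidef_gram hS J))
  set b := S.B * S.Bᵀ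
  -- This square replaces Cauchy–Schwarz: 2δ⟨Q, b⟩ ≤ δ²‖Q‖² + ‖b‖².
  have h3 : 0 ≤ ((δ • Q - b)ᵀ * (δ • Q - b)).trace := by
    rw [Matrix.trace_transpose_mul_eq_sum]
    exact Finset.sum_nonneg fun _ _ => Finset.sum_nonneg fun _ _ => mul_self_nonneg _
  have h4 : ((δ • Q - b)ᵀ * (δ • Q - b)).trace
      = δ ^ 2 * (Qᵀ * Q).trace - 2 * δ * (Qᵀ * b).trace + (bᵀ * b).trace := by
    simp only [Matrix.transpose_sub, Matrix.transpose_smul, Matrix.mul_sub, Matrix.sub_mul,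
      Matrix.trace_sub, Matrix.smul_mul, Matrix.mul_smul, Matrix.trace_smul, smul_eq_mul]
    rw [Matrix.trace_transpose_mul_comm b Q]
    ring
  rw [le_div_iff₀ (by positivity)]
  nlinarith

theorem summable_gram_self_apply {S : BilinearSystem ι m r} (hS : (-S.A).PosDef)
    (h : S.IsCoercive) (a : ι) : Summable fun j => gram S S j a a := by
  obtain ⟨δ, hδ, h⟩ := h
  refine summable_of_sum_range_le (fun j => (posSemidef_gram hS j).diag_nonneg)
    (c := √(((S.B * S.Bᵀ)ᵀ * (S.B * S.Bᵀ)).trace / δ ^ 2)) fun J => ?_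
  -- The uniform bound covers only nonempty ranges, so one nonnegative term is added first.
  have h0 : ∑ j ∈ Finset.range J, gram S S j a a ≤ ∑ j ∈ Finset.range (J + 1), gram S S j a a := by
    rw [Finset.sum_range_succ]
    exact le_add_of_nonneg_right (posSemidef_gram hS J).diag_nonneg
  refine h0.trans (Real.le_sqrt_of_sq_le (le_trans ?_ (trace_sum_gram_le hS hδ h J)))
  rw [← Matrix.sum_apply]
  exact Matrix.sq_apply_le_trace _ a a

theorem summable_gram {S : BilinearSystem ι m r} {T : BilinearSystem κ m r}
    (hS : (-S.A).PosDef) (hT : (-T.A).PosDef) (hS' : S.IsCoercive) (hT' : T.IsCoercive) :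
    Summable fun j => gram S T j := by
  refine Pi.summable.2 fun a => Pi.summable.2 fun b => ?_
  refine Summable.of_norm_bounded
    ((summable_gram_self_apply hS hS' a).add (summable_gram_self_apply hT hT' b)) fun j => ?_
  exact abs_gram_apply_le hS hT j a b

theorem negLyapunov_tsum_gram {S : BilinearSystem ι m r} {T : BilinearSystem κ m r}
    (hS : (-S.A).PosDef) (hT : (-T.A).PosDef) (h : Summable fun j => gram S T j) :
    negLyapunov S T (∑' j, gram S T j) = S.B * T.Bᵀ := by
  have hc : Continuous (negLyapunov S T) := by
    have := continuous_mixedCorrection S T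
    unfold negLyapunov
    fun_prop
  have h1 := (hc.tendsto _).comp (h.hasSum.tendsto_sum_nat.comp (tendsto_add_atTop_nat 1))
  have h2 : Tendsto (fun J => S.B * T.Bᵀ - mixedCorrection S T (gram S T J)) atTop
      (𝓝 (S.B * T.Bᵀ - mixedCorrection S T 0)) :=
    (((continuous_mixedCorrection S T).tendsto 0).comp h.tendsto_atTop_zero).const_sub _
  rw [mixedCorrection_zero, sub_zero] at h2
  refine tendsto_nhds_unique (h1.congr fun J => ?_) h2
  exact negLyapunov_sum_gram hS hT J

end BilinearSystem

/-! ### From the spectral radius to coercivity. -/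

theorem norm_le_realSpectralRadius {E : Type*} [AddCommGroup E] [Module ℝ E] {T : Module.End ℝ E}
    {x : E} (hx : x ≠ 0) {μ : ℝ} (h : T x = μ • x) :
    ENNReal.ofReal |μ| ≤ realSpectralRadius T := by
  have hx' : (1 : ℂ) ⊗ₜ[ℝ] x ≠ 0 := fun h0 =>
    hx ((Module.FaithfullyFlat.one_tmul_eq_zero_iff ℝ E x).1 h0)
  have hv : Module.End.HasEigenvector (LinearMap.baseChange ℂ T) (μ : ℂ)
      ((1 : ℂ) ⊗ₜ[ℝ] x) := by
    refine ⟨Module.End.mem_eigenspace_iff.2 ?_, hx'⟩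
    rw [LinearMap.baseChange_tmul, h, TensorProduct.tmul_smul, ← algebraMap_smul ℂ μ]
    rfl
  have hs := (Module.End.hasEigenvalue_of_hasEigenvector hv).mem_spectrum
  refine le_trans (le_of_eq ?_) (le_iSup₂ (f := fun k _ => (‖k‖₊ : ℝ≥0∞)) (μ : ℂ) hs)
  rw [← enorm_eq_nnnorm, ← ofReal_norm, Complex.norm_real, Real.norm_eq_abs]

/-- The ratio is invariant under scaling, so its maximum over the compact unit sphere is global. -/
theorem exists_isMaxOn_ratio {E : Type*} [NormedAddCommGroup E] [NormedSpace ℝ E]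
    [FiniteDimensional ℝ E] [Nontrivial E] {q p : E → ℝ} (hq : Continuous q) (hp : Continuous p)
    (hq2 : ∀ (c : ℝ) x, q (c • x) = c ^ 2 * q x) (hp2 : ∀ (c : ℝ) x, p (c • x) = c ^ 2 * p x)
    (hpos : ∀ x, x ≠ 0 → 0 < p x) : ∃ x₀ ≠ 0, ∀ x, q x ≤ q x₀ / p x₀ * p x := by
  have hne : ∀ x ∈ Metric.sphere (0 : E) 1, x ≠ 0 := fun x hx => ne_zero_of_mem_unit_sphere ⟨x, hx⟩
  obtain ⟨x₀, hx₀, hmax⟩ := (isCompact_sphere (0 : E) 1).exists_isMaxOn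
    (NormedSpace.sphere_nonempty.2 zero_le_one)
    (hq.continuousOn.div hp.continuousOn fun x hx => (hpos x (hne x hx)).ne')
  refine ⟨x₀, hne x₀ hx₀, fun x => ?_⟩
  by_cases hx : x = 0
  · have h1 := hq2 0 0
    have h2 := hp2 0 0
    simp only [smul_zero, ne_eq, OfNat.ofNat_ne_zero, not_false_eq_true, zero_pow, zero_mul]
      at h1 h2
    simp [hx, h1, h2]
  · have hn : ‖x‖ ≠ 0 := norm_ne_zero_iff.2 hx
    have hmem : ‖x‖⁻¹ • x ∈ Metric.sphere (0 : E) 1 := by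
      simp [norm_smul, hn]
    have h := hmax hmem
    simp only [Set.mem_ofPred_eq, Pi.div_apply] at h
    rw [← div_le_iff₀ (hpos x hx)]
    refine le_trans (le_of_eq ?_) h
    rw [hq2, hp2, mul_div_mul_left _ _ (by positivity)]

/-- A null vector X of a nonnegative symmetric form minimizes it. Perturbing X along Z = H X has
first-order term 2t‖Z‖², which must vanish. -/
theorem Matrix.eq_zero_of_trace_quadratic_eq_zero {ι κ : Type*} [Fintype ι] [Fintype κ]
    {H : Matrix ι κ ℝ → Matrix ι κ ℝ} (hadd : ∀ X Y, H (X + Y) = H X + H Y)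
    (hsmul : ∀ (c : ℝ) X, H (c • X) = c • H X)
    (hsymm : ∀ X Y, (Xᵀ * H Y).trace = (Yᵀ * H X).trace)
    (hnonneg : ∀ X, 0 ≤ (Xᵀ * H X).trace) {X : Matrix ι κ ℝ} (hX : (Xᵀ * H X).trace = 0) :
    H X = 0 := by
  set Z := H X with hZ
  set z := (Zᵀ * Z).trace with hz
  set f := (Zᵀ * H Z).trace with hf
  have hf0 : 0 ≤ f := hnonneg Z
  have hz0 : 0 ≤ z := by
    rw [hz, Matrix.trace_transpose_mul_eq_sum]
    exact Finset.sum_nonneg fun _ _ => Finset.sum_nonneg fun _ _ => mul_self_nonneg _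
  have key : ∀ t : ℝ, 0 ≤ 2 * t * z + t ^ 2 * f := by
    intro t
    have h := hnonneg (X + t • Z)
    rw [hadd, hsmul] at h
    simp only [Matrix.transpose_add, Matrix.transpose_smul, Matrix.mul_add, Matrix.add_mul,
      Matrix.smul_mul, Matrix.mul_smul, Matrix.trace_add, Matrix.trace_smul, smul_eq_mul] at h
    rw [hsymm X Z, ← hZ, ← hz, ← hf] at h
    linarith
  have hz1 : z = 0 := by
    by_contra hne
    have hzpos : 0 < z := lt_of_le_of_ne hz0 (Ne.symm hne)
    -- The minimizing t would be -z/f; adding 1 avoids division by zero and keeps the value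
    -- negative.
    have h := key (-(z / (f + 1)))
    have hfe : z / (f + 1) * f ≤ z := by
      rw [div_mul_eq_mul_div, div_le_iff₀ (by linarith)]
      nlinarith
    have he : 0 < z / (f + 1) := by positivity
    nlinarith
  ext a b
  have h := Matrix.sq_apply_le_trace Z a b
  rw [← hz, hz1] at h
  exact pow_eq_zero_iff two_ne_zero |>.1 (le_antisymm h (sq_nonneg _))

theorem Matrix.PosDef.trace_transpose_mul_mul_pos {ι κ : Type*} [Fintype ι] [Fintype κ]
    {P : Matrix ι ι ℝ} (hP : P.PosDef) {X : Matrix ι κ ℝ} (hX : X ≠ 0) :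
    0 < (Xᵀ * (P * X)).trace := by
  have h : ∀ b, (Xᵀ * (P * X)) b b = star (fun a => X a b) ⬝ᵥ P *ᵥ (fun a => X a b) := fun b => rfl
  have h0 : ∀ b, 0 ≤ (Xᵀ * (P * X)) b b := fun b => by
    rw [h]
    exact hP.posSemidef.dotProduct_mulVec_nonneg _
  refine lt_of_le_of_ne (Finset.sum_nonneg fun b _ => h0 b) fun h1 => hX ?_
  have h2 := (Finset.sum_eq_zero_iff_of_nonneg fun b _ => h0 b).1 h1.symm
  ext a b
  by_contra hne
  refine (hP.dotProduct_mulVec_pos (x := fun a => X a b) fun h3 => hne (congrFun h3 a)).ne' ?_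
  rw [← h]
  exact h2 b (Finset.mem_univ b)

namespace BilinearSystem

section Symmetric

variable {ι κ : Type*} [Fintype ι] [Fintype κ] {m r : ℕ}

theorem trace_lyapunov_comm {S : BilinearSystem ι m r} {T : BilinearSystem κ m r}
    (hS : S.A.IsSymm) (hT : T.A.IsSymm) (X Y : Matrix ι κ ℝ) :
    (Xᵀ * (S.A * Y + Y * T.Aᵀ)).trace = (Yᵀ * (S.A * X + X * T.Aᵀ)).trace := by
  simp only [Matrix.mul_add, Matrix.trace_add]
  congr 1
  · rw [← Matrix.trace_transpose]
    simp [Matrix.transpose_mul, hS.eq, Matrix.mul_assoc]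
  · rw [← Matrix.trace_transpose, hT.eq, ← Matrix.mul_assoc, ← Matrix.mul_assoc,
      Matrix.trace_mul_comm (Yᵀ * X)]
    simp [Matrix.transpose_mul, hT.eq]

theorem trace_mixedCorrection_comm {S : BilinearSystem ι m r} {T : BilinearSystem κ m r}
    (hS : ∀ i, (S.N i).IsSymm) (hT : ∀ i, (T.N i).IsSymm) (X Y : Matrix ι κ ℝ) :
    (Xᵀ * mixedCorrection S T Y).trace = (Yᵀ * mixedCorrection S T X).trace := by
  simp only [mixedCorrection, Matrix.mul_sum, Matrix.trace_sum]
  refine Finset.sum_congr rfl fun i _ => ?_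
  rw [← Matrix.trace_transpose, (hT i).eq, ← Matrix.mul_assoc Yᵀ,
    Matrix.trace_mul_comm _ (T.N i)]
  simp [Matrix.transpose_mul, (hS i).eq, (hT i).eq, Matrix.mul_assoc]

theorem trace_negLyapunov_comm {S : BilinearSystem ι m r} {T : BilinearSystem κ m r}
    (hS : S.A.IsSymm) (hT : T.A.IsSymm)
    (hSN : ∀ i, (S.N i).IsSymm) (hTN : ∀ i, (T.N i).IsSymm) (X Y : Matrix ι κ ℝ) :
    (Xᵀ * negLyapunov S T Y).trace = (Yᵀ * negLyapunov S T X).trace := by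
  simp only [negLyapunov, Matrix.mul_neg, Matrix.trace_neg]
  rw [Matrix.mul_add, Matrix.trace_add, trace_lyapunov_comm hS hT,
    trace_mixedCorrection_comm hSN hTN, ← Matrix.trace_add, ← Matrix.mul_add]

theorem trace_lyapunov_neg {S : BilinearSystem ι m r} {T : BilinearSystem κ m r}
    (hS : (-S.A).PosDef) (hT : (-T.A).PosDef) {X : Matrix ι κ ℝ} (hX : X ≠ 0) :
    (Xᵀ * (S.A * X + X * T.Aᵀ)).trace < 0 := by
  have h1 := hS.trace_transpose_mul_mul_pos hX
  have h2 := hT.transpose.trace_transpose_mul_mul_pos (X := Xᵀ) (by simpa using hX)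
  have h3 : (Xᵀ * (X * T.Aᵀ)).trace = -((Xᵀ)ᵀ * ((-T.A)ᵀ * Xᵀ)).trace := by
    rw [← Matrix.mul_assoc Xᵀ, Matrix.mul_assoc Xᵀ, Matrix.trace_mul_comm]
    simp [Matrix.mul_assoc]
  rw [Matrix.mul_add, Matrix.trace_add, h3]
  rw [Matrix.neg_mul, Matrix.mul_neg, Matrix.trace_neg] at h1
  linarith

end Symmetric

section

attribute [local instance] Matrix.normedAddCommGroup Matrix.normedSpace

theorem isCoercive_of_realSpectralRadius_lt_one {n m r : ℕ} (S : BilinearSystem (Fin n) m r)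
    (hA : S.A.IsSymm) (hAneg : (-S.A).PosDef) (hN : ∀ i, (S.N i).IsSymm)
    (hρ : realSpectralRadius (Ring.inverse (lyapunovOp S.A) * correctionOp S.N) < 1) :
    S.IsCoercive := by
  have hLlt : ∀ {X : Matrix (Fin n) (Fin n) ℝ}, X ≠ 0 → (Xᵀ * lyapunovOp S.A X).trace < 0 :=
    fun hX => trace_lyapunov_neg hAneg hAneg hX
  have hP : ∀ X, correctionOp S.N X = mixedCorrection S S X := correctionOp_apply S.N
  -- `Ring.inverse` is a true inverse only on units; elsewhere its value is 0.
  have hunit : IsUnit (lyapunovOp S.A) := by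
    rw [LinearMap.isUnit_iff_ker_eq_bot, LinearMap.ker_eq_bot']
    intro X hX
    by_contra hne
    have h := hLlt hne
    rw [hX] at h
    simp at h
  -- For n = 0 there is no nonzero matrix on which to take a Rayleigh quotient.
  rcases subsingleton_or_nontrivial (Matrix (Fin n) (Fin n) ℝ) with hs | hnt
  · refine ⟨1, one_pos, fun X => ?_⟩
    rw [Subsingleton.elim X 0]
    simp
  have cL : Continuous fun X : Matrix (Fin n) (Fin n) ℝ => -(Xᵀ * lyapunovOp S.A X).trace := by
    simp only [lyapunovOp_apply]
    fun_prop
  have cP : Continuous fun X : Matrix (Fin n) (Fin n) ℝ => (Xᵀ * correctionOp S.N X).trace := by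
    simp only [correctionOp_apply]
    fun_prop
  have hom : ∀ (F : Module.End ℝ (Matrix (Fin n) (Fin n) ℝ)) (c : ℝ) X,
      ((c • X)ᵀ * F (c • X)).trace = c ^ 2 * (Xᵀ * F X).trace := by
    intro F c X
    simp only [map_smul, Matrix.transpose_smul, Matrix.smul_mul, Matrix.mul_smul,
      Matrix.trace_smul, smul_eq_mul]
    ring
  obtain ⟨X₀, hX₀, hmax⟩ := exists_isMaxOn_ratio cP cL (hom _)
    (fun c X => by rw [hom]; ring) fun X hX => neg_pos.2 (hLlt hX)
  -- A second ratio compares ‖X‖² with the form of -L: its maximum ν satisfies ‖X‖² ≤ ν⟨X, -LX⟩. The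
  -- final constant (1 - μ)/ν combines this with ⟨X, ΠX⟩ ≤ μ⟨X, -LX⟩.
  obtain ⟨X₁, hX₁, hmax₁⟩ := exists_isMaxOn_ratio
    (q := fun X : Matrix (Fin n) (Fin n) ℝ => (Xᵀ * X).trace) (by fun_prop) cL (hom 1)
    (fun c X => by rw [hom]; ring) fun X hX => neg_pos.2 (hLlt hX)
  set μ := (X₀ᵀ * correctionOp S.N X₀).trace / -(X₀ᵀ * lyapunovOp S.A X₀).trace with hμ
  -- By maximality of μ the form of -μL - Π is nonnegative, and it vanishes at `X₀`; so the operator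
  -- itself kills `X₀`.
  have hzero : (-(μ • lyapunovOp S.A) - correctionOp S.N) X₀ = 0 := by
    have happ : ∀ X Y : Matrix (Fin n) (Fin n) ℝ,
        (Xᵀ * (-(μ • lyapunovOp S.A) - correctionOp S.N) Y).trace
          = -(μ * (Xᵀ * lyapunovOp S.A Y).trace) - (Xᵀ * correctionOp S.N Y).trace := by
      intro X Y
      simp only [LinearMap.sub_apply, LinearMap.neg_apply, LinearMap.smul_apply, Matrix.mul_sub,
        Matrix.mul_neg, Matrix.mul_smul, Matrix.trace_sub, Matrix.trace_neg, Matrix.trace_smul,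
        smul_eq_mul]
    refine Matrix.eq_zero_of_trace_quadratic_eq_zero
      (H := fun X => (-(μ • lyapunovOp S.A) - correctionOp S.N) X) (map_add _) (map_smul _) ?_ ?_ ?_
    · intro X Y
      rw [happ, happ, hP, hP, trace_mixedCorrection_comm hN hN X Y, lyapunovOp_apply,
        lyapunovOp_apply, trace_lyapunov_comm hA hA X Y]
    · intro X
      rw [happ]
      have := hmax X
      linarith
    · rw [happ, ← mul_neg, hμ, div_mul_cancel₀ _ (neg_pos.2 (hLlt hX₀)).ne', sub_self]
  have heig : (Ring.inverse (lyapunovOp S.A) * correctionOp S.N) X₀ = (-μ) • X₀ := by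
    have h1 : correctionOp S.N X₀ = (-μ) • lyapunovOp S.A X₀ := by
      rw [LinearMap.sub_apply, sub_eq_zero] at hzero
      rw [← hzero]
      simp
    rw [Module.End.mul_apply, h1, map_smul, ← Module.End.mul_apply, Ring.inverse_mul_cancel _ hunit]
    rfl
  have hμ1 : μ < 1 := by
    have h := (norm_le_realSpectralRadius hX₀ heig).trans_lt hρ
    rw [abs_neg, ENNReal.ofReal_lt_one] at h
    exact (le_abs_self μ).trans_lt h
  have hd₁ := neg_pos.2 (hLlt hX₁)
  have hi₁ : 0 < (X₁ᵀ * X₁).trace := by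
    simpa using Matrix.PosDef.one.trace_transpose_mul_mul_pos hX₁
  set ν := (X₁ᵀ * X₁).trace / -(X₁ᵀ * lyapunovOp S.A X₁).trace with hν
  have hν0 : 0 < ν := div_pos hi₁ hd₁
  refine ⟨(1 - μ) / ν, div_pos (by linarith) hν0, fun X => ?_⟩
  have h1 := hmax X
  have h2 := hmax₁ X
  have h3 : (Xᵀ * negLyapunov S S X).trace
      = -(Xᵀ * lyapunovOp S.A X).trace - (Xᵀ * correctionOp S.N X).trace := by
    rw [negLyapunov, hP, lyapunovOp_apply, Matrix.mul_neg, Matrix.trace_neg,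
      Matrix.mul_add, Matrix.trace_add]
    ring
  rw [h3, div_mul_eq_mul_div, div_le_iff₀ hν0]
  nlinarith

end

end BilinearSystem

/-! ### The H₂-norm in terms of Gramians, and the error system. -/

theorem Matrix.hasSum_exp {ι : Type*} [Fintype ι] [DecidableEq ι] (A : Matrix ι ι ℝ) :
    HasSum (fun n : ℕ => ((n.factorial : ℝ)⁻¹) • A ^ n) (NormedSpace.exp A) := by
  let _ : NormedRing (Matrix ι ι ℝ) := Matrix.linftyOpNormedRing
  let _ : NormedAlgebra ℝ (Matrix ι ι ℝ) := Matrix.linftyOpNormedAlgebra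
  exact NormedSpace.exp_series_hasSum_exp' (𝕂 := ℝ) A

theorem Matrix.exp_fromBlocks_diagonal {ι κ : Type*} [Fintype ι] [DecidableEq ι] [Fintype κ]
    [DecidableEq κ] (A : Matrix ι ι ℝ) (B : Matrix κ κ ℝ) :
    NormedSpace.exp (Matrix.fromBlocks A 0 0 B)
      = Matrix.fromBlocks (NormedSpace.exp A) 0 0 (NormedSpace.exp B) := by
  refine (Matrix.hasSum_exp _).unique (Pi.hasSum.2 fun a => Pi.hasSum.2 fun b => ?_)
  simp only [Matrix.fromBlocks_diagonal_pow, Matrix.fromBlocks_smul]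
  rcases a with a | a <;> rcases b with b | b
  · exact Pi.hasSum.1 (Pi.hasSum.1 (Matrix.hasSum_exp A) a) b
  · simp
  · simp
  · exact Pi.hasSum.1 (Pi.hasSum.1 (Matrix.hasSum_exp B) a) b

namespace BilinearSystem

variable {ι κ : Type*} [Fintype ι] [DecidableEq ι] [Fintype κ] [DecidableEq κ] {m r : ℕ}

theorem sum_vecMulVec_volterraKernel (S : BilinearSystem ι m r) (j : ℕ) (s : Fin (j + 1) → ℝ) :
    ∑ ℓ : Fin j → Fin m, ∑ a : Fin r,
        Matrix.vecMulVec (S.volterraKernel j ℓ a s) (S.volterraKernel j ℓ a s)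
      = S.C * gramKernel S S j s * S.Cᵀ := by
  rw [gramKernel, Matrix.mul_sum, Matrix.sum_mul]
  refine Finset.sum_congr rfl fun ℓ _ => ?_
  rw [← Matrix.mul_assoc, Matrix.mul_assoc (S.C * _)]
  ext p q
  rw [← Matrix.transpose_mul, Matrix.mul_apply]
  simp [Matrix.sum_apply, Matrix.vecMulVec_apply, volterraKernel]

/-- Integrability and summability are hypotheses, so that the error system is covered as well: there
both are checked block by block. -/
theorem h2NormSq_eq_ofReal {S : BilinearSystem ι m r}
    (hi : ∀ j a b, IntegrableOn (fun s => gramKernel S S j s a b) (Set.Ici 0))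
    {Q : Matrix ι ι ℝ} (hQ : HasSum (fun j => gram S S j) Q) :
    S.h2NormSq = ENNReal.ofReal (S.C * Q * S.Cᵀ).trace ∧ 0 ≤ (S.C * Q * S.Cᵀ).trace := by
  have hker : ∀ j s p, 0 ≤ (S.C * gramKernel S S j s * S.Cᵀ) p p := fun j s p => by
    have h := (posSemidef_gramKernel S j s).mul_mul_conjTranspose_same S.C
    rw [Matrix.conjTranspose_eq_transpose_of_trivial] at h
    exact h.diag_nonneg
  have hint : ∀ j p, IntegrableOn (fun s => (S.C * gramKernel S S j s * S.Cᵀ) p p) (Set.Ici 0) := by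
    intro j p
    simp only [Matrix.mul_apply, Finset.sum_mul]
    exact integrable_finsetSum _ fun b _ => integrable_finsetSum _ fun a _ =>
      ((hi j a b).const_mul _).mul_const _
  have hval : ∀ j p, ∫ s in Set.Ici (0 : Fin (j + 1) → ℝ), (S.C * gramKernel S S j s * S.Cᵀ) p p
      = (S.C * gram S S j * S.Cᵀ) p p := by
    intro j p
    simp only [Matrix.mul_apply, Finset.sum_mul]
    rw [integral_finsetSum _ fun b _ => integrable_finsetSum _ fun a _ =>
      ((hi j a b).const_mul _).mul_const _]
    refine Finset.sum_congr rfl fun b _ => ?_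
    rw [integral_finsetSum _ fun a _ => ((hi j a b).const_mul _).mul_const _]
    refine Finset.sum_congr rfl fun a _ => ?_
    rw [integral_mul_const, integral_const_mul]
    rfl
  have hsum : ∀ p, HasSum (fun j => (S.C * gram S S j * S.Cᵀ) p p) ((S.C * Q * S.Cᵀ) p p) := by
    intro p
    simp only [Matrix.mul_apply, Finset.sum_mul]
    exact hasSum_sum fun b _ => hasSum_sum fun a _ =>
      ((Pi.hasSum.1 (Pi.hasSum.1 hQ a) b).mul_left _).mul_right _
  have hnn : ∀ j p, 0 ≤ (S.C * gram S S j * S.Cᵀ) p p := fun j p => by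
    rw [← hval]
    exact integral_nonneg fun s => hker j s p
  have hQnn : ∀ p, 0 ≤ (S.C * Q * S.Cᵀ) p p := fun p => (hsum p).nonneg fun j => hnn j p
  refine ⟨?_, Finset.sum_nonneg fun p _ => hQnn p⟩
  have htr : (S.C * Q * S.Cᵀ).trace = ∑ p, (S.C * Q * S.Cᵀ) p p := rfl
  rw [h2NormSq, htr, ENNReal.ofReal_sum_of_nonneg fun p _ => hQnn p]
  refine Finset.sum_congr rfl fun p _ => ?_
  rw [← (hsum p).tsum_eq, ENNReal.ofReal_tsum_of_nonneg (fun j => hnn j p)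
    (hsum p).summable]
  refine tsum_congr fun j => ?_
  rw [← hval, ofReal_integral_eq_lintegral_ofReal (hint j p)
    (Eventually.of_forall fun s => hker j s p)]
  simp only [sum_vecMulVec_volterraKernel]

theorem stateKernel_errorSystem (S : BilinearSystem ι m r) (T : BilinearSystem κ m r) (j : ℕ)
    (ℓ : Fin j → Fin m) (s : Fin (j + 1) → ℝ) :
    (S.errorSystem T).stateKernel j ℓ s
      = Matrix.fromRows (S.stateKernel j ℓ s) (T.stateKernel j ℓ s) := by
  have hexp : ∀ t : ℝ, NormedSpace.exp (t • (S.errorSystem T).A)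
      = Matrix.fromBlocks (NormedSpace.exp (t • S.A)) 0 0 (NormedSpace.exp (t • T.A)) := by
    intro t
    rw [← Matrix.exp_fromBlocks_diagonal, errorSystem, Matrix.fromBlocks_smul]
    simp
  induction j with
  | zero =>
    simp only [stateKernel, hexp]
    simp [errorSystem, Matrix.fromBlocks_mul_fromRows]
  | succ j ih =>
    simp only [stateKernel, hexp, ih]
    simp [errorSystem, Matrix.fromBlocks_multiply, Matrix.fromBlocks_mul_fromRows]

theorem gramKernel_errorSystem (S : BilinearSystem ι m r) (T : BilinearSystem κ m r) (j : ℕ)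
    (s : Fin (j + 1) → ℝ) :
    gramKernel (S.errorSystem T) (S.errorSystem T) j s
      = Matrix.fromBlocks (gramKernel S S j s) (gramKernel S T j s) (gramKernel T S j s)
        (gramKernel T T j s) := by
  simp only [gramKernel, stateKernel_errorSystem, Matrix.transpose_fromRows,
    Matrix.fromRows_mul_fromCols]
  ext (a | a) (b | b) <;> simp [Matrix.sum_apply]

theorem gramKernel_comm (S : BilinearSystem ι m r) (T : BilinearSystem κ m r) (j : ℕ)
    (s : Fin (j + 1) → ℝ) : gramKernel T S j s = (gramKernel S T j s)ᵀ := by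
  simp [gramKernel, Matrix.transpose_sum, Matrix.transpose_mul]

theorem gram_comm (S : BilinearSystem ι m r) (T : BilinearSystem κ m r) (j : ℕ) :
    gram T S j = (gram S T j)ᵀ := by
  ext a b
  simp only [gram, gramKernel_comm S T, Matrix.of_apply, Matrix.transpose_apply]

theorem h2NormSq_errorSystem {S : BilinearSystem ι m r} {T : BilinearSystem κ m r}
    (hS : (-S.A).PosDef) (hT : (-T.A).PosDef) (hS' : S.IsCoercive) (hT' : T.IsCoercive) :
    (S.errorSystem T).h2NormSq = ENNReal.ofReal
        ((S.C * (∑' j, gram S S j) * S.Cᵀ).trace - 2 * (S.C * (∑' j, gram S T j) * T.Cᵀ).trace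
          + (T.C * (∑' j, gram T T j) * T.Cᵀ).trace) ∧
      0 ≤ (S.C * (∑' j, gram S S j) * S.Cᵀ).trace - 2 * (S.C * (∑' j, gram S T j) * T.Cᵀ).trace
          + (T.C * (∑' j, gram T T j) * T.Cᵀ).trace := by
  have hSS := (summable_gram hS hS hS' hS').hasSum
  have hST := (summable_gram hS hT hS' hT').hasSum
  have hTS := hST.matrix_transpose
  simp only [← gram_comm] at hTS
  have hTT := (summable_gram hT hT hT' hT').hasSum
  set P := ∑' j, gram S S j
  set Y := ∑' j, gram S T j
  set Z := ∑' j, gram T T j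
  have hi : ∀ j a b, IntegrableOn
      (fun s => gramKernel (S.errorSystem T) (S.errorSystem T) j s a b) (Set.Ici 0) := by
    intro j a b
    simp only [gramKernel_errorSystem]
    rcases a with a | a <;> rcases b with b | b
    · exact integrableOn_gramKernel hS hS j a b
    · exact integrableOn_gramKernel hS hT j a b
    · exact integrableOn_gramKernel hT hS j a b
    · exact integrableOn_gramKernel hT hT j a b
  have hsum : HasSum (fun j => gram (S.errorSystem T) (S.errorSystem T) j)
      (Matrix.fromBlocks P Y Yᵀ Z) := by
    refine Pi.hasSum.2 fun a => Pi.hasSum.2 fun b => ?_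
    simp only [gram, gramKernel_errorSystem]
    rcases a with a | a <;> rcases b with b | b
    · exact Pi.hasSum.1 (Pi.hasSum.1 hSS a) b
    · exact Pi.hasSum.1 (Pi.hasSum.1 hST a) b
    · exact Pi.hasSum.1 (Pi.hasSum.1 hTS a) b
    · exact Pi.hasSum.1 (Pi.hasSum.1 hTT a) b
  have hval : ((S.errorSystem T).C * Matrix.fromBlocks P Y Yᵀ Z * (S.errorSystem T).Cᵀ).trace
      = (S.C * P * S.Cᵀ).trace - 2 * (S.C * Y * T.Cᵀ).trace + (T.C * Z * T.Cᵀ).trace := by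
    have h : (T.C * Yᵀ * S.Cᵀ).trace = (S.C * Y * T.Cᵀ).trace := by
      rw [← Matrix.trace_transpose]
      simp [Matrix.transpose_mul, Matrix.mul_assoc]
    simp only [errorSystem, Matrix.transpose_fromCols, Matrix.fromCols_mul_fromBlocks,
      Matrix.fromCols_mul_fromRows, Matrix.trace_add, Matrix.transpose_neg, Matrix.neg_mul,
      Matrix.mul_neg, Matrix.add_mul, Matrix.trace_neg, h]
    ring
  rw [← hval]
  exact h2NormSq_eq_ofReal hi hsum

end BilinearSystem

/-! ### Compression to the reduced system and the Galerkin inequality. -/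

namespace BilinearSystem

section Reduction

variable {n k m r : ℕ} {S : BilinearSystem (Fin n) m r} {V : Matrix (Fin n) (Fin k) ℝ}

theorem symmReduction_A_isSymm (hA : S.A.IsSymm) : (S.symmReduction V).A.IsSymm := by
  simp [symmReduction, Matrix.IsSymm, Matrix.transpose_mul, hA.eq, Matrix.mul_assoc]

theorem symmReduction_N_isSymm (hN : ∀ i, (S.N i).IsSymm) (i : Fin m) :
    ((S.symmReduction V).N i).IsSymm := by
  simp [symmReduction, Matrix.IsSymm, Matrix.transpose_mul, (hN i).eq, Matrix.mul_assoc]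

theorem posDef_neg_symmReduction (hV : Vᵀ * V = 1) (hA : (-S.A).PosDef) :
    (-(S.symmReduction V).A).PosDef := by
  have hinj : Function.Injective V.mulVec :=
    Function.LeftInverse.injective (g := Vᵀ.mulVec) fun x => by
      rw [Matrix.mulVec_mulVec, hV, Matrix.one_mulVec]
  have h := hA.conjTranspose_mul_mul_same hinj
  rw [Matrix.conjTranspose_eq_transpose_of_trivial] at h
  simpa [symmReduction] using h

/-- As VᵀV = 1, X ↦ X Vᵀ is an isometric embedding and right multiplication by V is its adjoint: the
mixed operator is a compression of the full one. -/
theorem negLyapunov_symmReduction_right (hV : Vᵀ * V = 1) (hA : S.A.IsSymm)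
    (hN : ∀ i, (S.N i).IsSymm) (X : Matrix (Fin n) (Fin k) ℝ) :
    negLyapunov S (S.symmReduction V) X = negLyapunov S S (X * Vᵀ) * V := by
  have hA' := symmReduction_A_isSymm (V := V) hA
  have hN' := symmReduction_N_isSymm (V := V) hN
  simp only [negLyapunov, mixedCorrection, hA.eq, hA'.eq, fun i => (hN i).eq, fun i => (hN' i).eq,
    Matrix.neg_mul, Matrix.add_mul, Matrix.sum_mul]
  simp only [symmReduction, Matrix.mul_assoc, hV, Matrix.mul_one]

theorem negLyapunov_symmReduction_self (hV : Vᵀ * V = 1) (Z : Matrix (Fin k) (Fin k) ℝ) :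
    negLyapunov (S.symmReduction V) (S.symmReduction V) Z
      = Vᵀ * negLyapunov S (S.symmReduction V) (V * Z) := by
  have hVZ : ∀ W : Matrix (Fin k) (Fin k) ℝ, Vᵀ * (V * W) = W := fun W => by
    rw [← Matrix.mul_assoc, hV, Matrix.one_mul]
  simp only [negLyapunov, mixedCorrection, Matrix.mul_neg, Matrix.mul_add, Matrix.mul_sum,
    Matrix.mul_assoc, hVZ]
  simp only [symmReduction, Matrix.mul_assoc]

theorem trace_negLyapunov_symmReduction_right (hV : Vᵀ * V = 1) (hA : S.A.IsSymm)
    (hN : ∀ i, (S.N i).IsSymm) (X : Matrix (Fin n) (Fin k) ℝ) :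
    (Xᵀ * negLyapunov S (S.symmReduction V) X).trace
      = ((X * Vᵀ)ᵀ * negLyapunov S S (X * Vᵀ)).trace := by
  rw [negLyapunov_symmReduction_right hV hA hN, ← Matrix.mul_assoc, Matrix.trace_mul_comm,
    Matrix.transpose_mul, Matrix.transpose_transpose, Matrix.mul_assoc]

theorem IsCoercive.symmReduction (hS : S.IsCoercive) (hV : Vᵀ * V = 1) (hA : S.A.IsSymm)
    (hN : ∀ i, (S.N i).IsSymm) : (S.symmReduction V).IsCoercive := by
  obtain ⟨δ, hδ, h⟩ := hS
  refine ⟨δ, hδ, fun Z => ?_⟩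
  have h1 := h (V * Z * Vᵀ)
  rw [← trace_negLyapunov_symmReduction_right hV hA hN] at h1
  rw [negLyapunov_symmReduction_self hV, ← Matrix.mul_assoc, ← Matrix.transpose_mul]
  refine le_trans (le_of_eq ?_) h1
  congr 1
  have h2 : (V * Z * Vᵀ)ᵀ * (V * Z * Vᵀ) = V * (Zᵀ * (Vᵀ * V) * Z) * Vᵀ := by
    simp only [Matrix.transpose_mul, Matrix.transpose_transpose, Matrix.mul_assoc]
  rw [h2, hV, Matrix.mul_one, Matrix.trace_mul_comm (V * (Zᵀ * Z)), ← Matrix.mul_assoc, hV,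
    Matrix.one_mul]

/-- Galerkin orthogonality: the energy ⟨Y - VZ, H(Y - VZ)⟩ equals ⟨Y, B B̂ᵀ⟩ - ⟨Z, B̂ B̂ᵀ⟩. The
cross terms and the energy of VZ are all ⟨Z, B̂ B̂ᵀ⟩ up to sign. -/
theorem trace_reduced_le_trace_mixed (hS : S.IsCoercive) (hV : Vᵀ * V = 1) (hA : S.A.IsSymm)
    (hN : ∀ i, (S.N i).IsSymm) {Y : Matrix (Fin n) (Fin k) ℝ} {Z : Matrix (Fin k) (Fin k) ℝ}
    (hY : negLyapunov S (S.symmReduction V) Y = S.B * (S.symmReduction V).Bᵀ)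
    (hZ : negLyapunov (S.symmReduction V) (S.symmReduction V) Z
      = (S.symmReduction V).B * (S.symmReduction V).Bᵀ) :
    ((S.symmReduction V).C * Z * (S.symmReduction V).Cᵀ).trace
      ≤ (S.Bᵀ * Y * (S.symmReduction V).Cᵀ).trace := by
  set R := S.symmReduction V with hR
  have hRC : R.C = R.Bᵀ := rfl
  have hRB : Vᵀ * (S.B * R.Bᵀ) = R.B * R.Bᵀ := by rw [← Matrix.mul_assoc]; rfl
  have h1 : (R.C * Z * R.Cᵀ).trace = (Zᵀ * (R.B * R.Bᵀ)).trace := by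
    rw [Matrix.trace_transpose_mul_comm, hRC, Matrix.transpose_mul, Matrix.transpose_transpose,
      Matrix.trace_mul_comm, ← Matrix.mul_assoc]
  have h2 : (S.Bᵀ * Y * R.Cᵀ).trace = (Yᵀ * (S.B * R.Bᵀ)).trace := by
    rw [Matrix.trace_transpose_mul_comm, hRC, Matrix.transpose_mul, Matrix.transpose_transpose,
      Matrix.trace_mul_comm, ← Matrix.mul_assoc]
  have h3 : 0 ≤ ((Y + V * -Z)ᵀ * negLyapunov S R (Y + V * -Z)).trace := by
    obtain ⟨δ, hδ, h⟩ := hS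
    rw [trace_negLyapunov_symmReduction_right hV hA hN]
    refine le_trans (mul_nonneg hδ.le ?_) (h _)
    rw [Matrix.trace_transpose_mul_eq_sum]
    exact Finset.sum_nonneg fun _ _ => Finset.sum_nonneg fun _ _ => mul_self_nonneg _
  have h4 : ((V * -Z)ᵀ * (S.B * R.Bᵀ)).trace = -(Zᵀ * (R.B * R.Bᵀ)).trace := by
    rw [Matrix.transpose_mul, Matrix.mul_assoc, hRB, Matrix.transpose_neg, Matrix.neg_mul,
      Matrix.trace_neg]
  have h5 : (Yᵀ * negLyapunov S R (V * -Z)).trace = ((V * -Z)ᵀ * (S.B * R.Bᵀ)).trace := by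
    rw [trace_negLyapunov_comm hA (symmReduction_A_isSymm hA) hN (symmReduction_N_isSymm hN), hY]
  have hneg : negLyapunov R R (-Z) = -(R.B * R.Bᵀ) := by
    rw [← hZ, eq_neg_iff_add_eq_zero, ← negLyapunov_add]
    simp [negLyapunov, mixedCorrection]
  have h6 : ((V * -Z)ᵀ * negLyapunov S R (V * -Z)).trace = (Zᵀ * (R.B * R.Bᵀ)).trace := by
    rw [Matrix.transpose_mul, Matrix.mul_assoc, ← negLyapunov_symmReduction_self hV, hneg]
    simp
  rw [negLyapunov_add, Matrix.transpose_add, Matrix.mul_add, Matrix.add_mul, Matrix.add_mul,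
    Matrix.trace_add, Matrix.trace_add, Matrix.trace_add, h5, h6, hY, h4] at h3
  rw [h1, h2]
  linarith

end Reduction

/-! ### Output scaling and the equality case. -/

section OutputScaling

variable {ι κ : Type*} [Fintype ι] [DecidableEq ι] [Fintype κ] [DecidableEq κ] {m r : ℕ}

/-- The system with its output matrix multiplied by `t`. -/
noncomputable def scaleOutput (T : BilinearSystem κ m r) (t : ℝ) : BilinearSystem κ m r :=
  { T with C := t • T.C }

theorem stateKernel_scaleOutput (T : BilinearSystem κ m r) (t : ℝ) (j : ℕ) (ℓ : Fin j → Fin m)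
    (s : Fin (j + 1) → ℝ) : (T.scaleOutput t).stateKernel j ℓ s = T.stateKernel j ℓ s := by
  induction j with
  | zero => rfl
  | succ j ih =>
    simp only [stateKernel, ih]
    rfl

theorem gram_scaleOutput_right (S : BilinearSystem ι m r) (T : BilinearSystem κ m r) (t : ℝ)
    (j : ℕ) : gram S (T.scaleOutput t) j = gram S T j := by
  simp only [gram, gramKernel, stateKernel_scaleOutput]

theorem gram_scaleOutput_left (S : BilinearSystem ι m r) (T : BilinearSystem κ m r) (t : ℝ)
    (j : ℕ) : gram (T.scaleOutput t) S j = gram T S j := by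
  simp only [gram, gramKernel, stateKernel_scaleOutput]

theorem continuous_scaleOutput {κ : Type*} (T : BilinearSystem κ m r) : Continuous T.scaleOutput := by
  refine continuous_induced_rng.2 ?_
  exact continuous_const.prodMk (continuous_const.prodMk (continuous_const.prodMk
    (continuous_id.smul continuous_const)))

theorem scaleOutput_one {κ : Type*} (T : BilinearSystem κ m r) : T.scaleOutput 1 = T := by
  simp [scaleOutput]

theorem h2NormSq_errorSystem_scaleOutput {S : BilinearSystem ι m r} {T : BilinearSystem κ m r}
    (hS : (-S.A).PosDef) (hT : (-T.A).PosDef) (hS' : S.IsCoercive) (hT' : T.IsCoercive) (t : ℝ) :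
    (S.errorSystem (T.scaleOutput t)).h2NormSq = ENNReal.ofReal
        ((S.C * (∑' j, gram S S j) * S.Cᵀ).trace
          - 2 * t * (S.C * (∑' j, gram S T j) * T.Cᵀ).trace
          + t ^ 2 * (T.C * (∑' j, gram T T j) * T.Cᵀ).trace) ∧
      0 ≤ (S.C * (∑' j, gram S S j) * S.Cᵀ).trace
          - 2 * t * (S.C * (∑' j, gram S T j) * T.Cᵀ).trace
          + t ^ 2 * (T.C * (∑' j, gram T T j) * T.Cᵀ).trace := by
  have h := h2NormSq_errorSystem (T := T.scaleOutput t) hS hT hS' hT'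
  have hC : (T.scaleOutput t).C = t • T.C := rfl
  simp only [gram_scaleOutput_right, gram_scaleOutput_left, hC, Matrix.transpose_smul,
    Matrix.smul_mul, Matrix.mul_smul, Matrix.trace_smul, smul_eq_mul] at h
  convert h using 3 <;> ring

theorem trace_eq_of_isLocallyH2Optimal {S : BilinearSystem ι m r} {T : BilinearSystem κ m r}
    (hS : (-S.A).PosDef) (hT : (-T.A).PosDef) (hS' : S.IsCoercive) (hT' : T.IsCoercive)
    (hopt : S.IsLocallyH2Optimal T) :
    (S.C * (∑' j, gram S T j) * T.Cᵀ).trace = (T.C * (∑' j, gram T T j) * T.Cᵀ).trace := by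
  obtain ⟨hst, hmin⟩ := hopt
  have hform := h2NormSq_errorSystem_scaleOutput hS hT hS' hT'
  set x := (S.C * (∑' j, gram S S j) * S.Cᵀ).trace
  set y := (S.C * (∑' j, gram S T j) * T.Cᵀ).trace
  set p := (T.C * (∑' j, gram T T j) * T.Cᵀ).trace
  -- Scaling the output leaves `A` unchanged, so the whole curve stays among the stable systems.
  have hlim : Tendsto T.scaleOutput (𝓝 1) (𝓝[{T' | T'.IsStable}] T) := by
    refine tendsto_nhdsWithin_iff.2 ⟨?_, Eventually.of_forall fun t => hst⟩
    have h := T.continuous_scaleOutput.tendsto 1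
    rwa [scaleOutput_one] at h
  have hloc : IsLocalMin (fun t : ℝ => x - 2 * t * y + t ^ 2 * p) 1 := by
    filter_upwards [hlim.eventually hmin] with t ht
    nth_rewrite 1 [← scaleOutput_one T] at ht
    rw [(hform 1).1, (hform t).1] at ht
    -- `ENNReal.ofReal` truncates negative numbers, so nonnegativity of the quadratic at t is needed
    -- to compare real values.
    exact (ENNReal.ofReal_le_ofReal_iff (hform t).2).1 ht
  have hder : HasDerivAt (fun t : ℝ => x - 2 * t * y + t ^ 2 * p) (-(2 * y) + 2 * p) 1 := by
    have h := ((((hasDerivAt_id (1 : ℝ)).const_mul 2).mul_const y).const_sub x).add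
      (((hasDerivAt_id (1 : ℝ)).pow 2).mul_const p)
    refine h.congr_deriv ?_
    simp
  have h0 := hloc.hasDerivAt_eq_zero hder
  linarith

end OutputScaling

end BilinearSystem

theorem mainTheorem4 {n k m r : ℕ} (hkn : k < n)
    (S : BilinearSystem (Fin n) m r)
    (hA : S.A.IsSymm) (hAneg : (-S.A).PosDef)
    (hN : ∀ i, (S.N i).IsSymm)
    (hBC : S.B = S.Cᵀ)
    (hρ : realSpectralRadius (Ring.inverse (lyapunovOp S.A) * correctionOp S.N) < 1)
    (V : Matrix (Fin n) (Fin k) ℝ) (hV : Vᵀ * V = 1) :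
    S.h2NormSq < ⊤ ∧ (S.symmReduction V).h2NormSq < ⊤ ∧
      (S.errorSystem (S.symmReduction V)).h2NormSq < ⊤ ∧
      (S.errorSystem (S.symmReduction V)).h2NormSq.toReal
        ≤ S.h2NormSq.toReal - (S.symmReduction V).h2NormSq.toReal ∧
      (S.IsLocallyH2Optimal (S.symmReduction V) →
        (S.errorSystem (S.symmReduction V)).h2NormSq.toReal
          = S.h2NormSq.toReal - (S.symmReduction V).h2NormSq.toReal) := by
  open BilinearSystem in
  have hS := isCoercive_of_realSpectralRadius_lt_one S hA hAneg hN hρ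
  have hR : (S.symmReduction V).IsCoercive := hS.symmReduction hV hA hN
  have hRneg := posDef_neg_symmReduction hV hAneg
  have hSsum := summable_gram hAneg hAneg hS hS
  have hYsum := summable_gram hAneg hRneg hS hR
  have hRsum := summable_gram hRneg hRneg hR hR
  obtain ⟨hSval, hSnn⟩ := h2NormSq_eq_ofReal (integrableOn_gramKernel hAneg hAneg) hSsum.hasSum
  obtain ⟨hRval, hRnn⟩ := h2NormSq_eq_ofReal (integrableOn_gramKernel hRneg hRneg) hRsum.hasSum
  obtain ⟨hEval, hEnn⟩ := h2NormSq_errorSystem hAneg hRneg hS hR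
  have hC : S.C = S.Bᵀ := by rw [hBC, Matrix.transpose_transpose]
  have hle := trace_reduced_le_trace_mixed hS hV hA hN
    (negLyapunov_tsum_gram hAneg hRneg hYsum) (negLyapunov_tsum_gram hRneg hRneg hRsum)
  rw [← hC] at hle
  rw [hSval, hRval, hEval, ENNReal.toReal_ofReal hSnn, ENNReal.toReal_ofReal hRnn,
    ENNReal.toReal_ofReal hEnn]
  refine ⟨ENNReal.ofReal_lt_top, ENNReal.ofReal_lt_top, ENNReal.ofReal_lt_top, by linarith,
    fun hopt => ?_⟩
  have := trace_eq_of_isLocallyH2Optimal hAneg hRneg hS hR hopt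
  linarith
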